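/- **Proposition (Instability of $\bar v = 0$).** Let $\mathcal G=(\mathcal V,\mathcal E)$ be a simple connected undirected graph with $\mathcal V=\{1,\dots,N\}$ and real edge weights $w_{jk}=w_{kj}$, let $B\in\mathbb R^{N\times|\mathcal E|}$ be its incidence matrix for an arbitrary direction of the edges, $L=B\,\mathrm{diag}(\{w_\ell\}_{\ell\in\mathcal E})\,B^\top$ its Laplacian, and $\mathcal L=L\otimes I_2$. Let $v_k^\star>0$ and $\theta_{k1}^\star\in\mathbb R$ ($k\in\mathcal V$) be magnitude and phase set-points, $\theta^\star_{jk}=\theta^\star_{j1}-\theta^\star_{k1}$, and let $R(\theta)=\begin{bmatrix}\cos\theta&-\sin\theta\\ \sin\theta&\cos\theta\end{bmatrix}$. Put $$K_k=\sum_{j:(j,k)\in\mathcal E}w_{jk}\Big(I_2-\frac{v_j^\star}{v_k^\star}R(\theta_{jk}^\star)\Big),\qquad \mathcal K=\mathrm{diag}(K_1,\dots,K_N),$$ $$\Phi_k(v_k)=\frac{v_k^\star-\|v_k\|}{v_k^\star},\qquad \Phi(v)=\mathrm{diag}\big(\Phi_1(v_1)I_2,\dots,\Phi_N(v_N)I_2\big),$$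 where $v=(v_1,\dots,v_N)\in\mathbb R^{2N}$, $v_k\in\mathbb R^2$, and $\|\cdot\|$ is the Euclidean norm. For $\eta>0$ and $\alpha>0$ consider the rotating-frame dynamics $$\frac{d}{dt}\bar v=\bar f(\bar v):=\eta(\mathcal K-\mathcal L)\bar v+\alpha\,\Phi(\bar v)\,\bar v\qquad\text{on }\mathbb R^{2N}.$$ For every $\bar v_0\in\mathbb R^{2N}$ there is exactly one solution on $[0,\infty)$ with $\bar v(0)=\bar v_0$; write $\varphi_{\bar f}(t,\bar v_0)$ for its value at time $t\ge 0$. Moreover: 1. The origin is an unstable equilibrium: $\bar f(0)=0$, and it is not true that for every $\epsilon>0$ there is $\delta>0$ such that $\|\bar v_0\|<\delta$ implies $\|\varphi_{\bar f}(t,\bar v_0)\|<\epsilon$ for all $t\ge0$. 2. $\bar f$ is differentiable at the origin with Jacobian $\eta(\mathcal K-\mathcal L)+\alpha I_{2N}$, and at least two of the complex eigenvalues of this matrix, counted with algebraic multiplicity, have positive real part. 3. The set $\mathcal Z=\{\bar v_0\in\mathbb R^{2N} : \lim_{t\to\infty}\varphi_{\bar f}(t,\bar v_0)=0\}$ has zero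 Lebesgue measure. -/

import Mathlib

open Set Filter Topology MeasureTheory
open scoped Kronecker

noncomputable section

/-- Data of `N` coupled planar oscillators: a simple connected graph on the oscillators with (real)
edge weights, an arbitrary direction for each edge, magnitude set-points and phase set-points. -/
structure OscillatorNetwork (N : ℕ) where
  /-- the interconnection graph -/
  graph : SimpleGraph (Fin N)
  connected : graph.Connected
  /-- the weight of each (undirected) edge; only the values at edges of `graph` are ever used -/
  weight : Sym2 (Fin N) → ℝ
  /-- the sink node of each edge; the other end point is the source node -/
  sink : graph.edgeSet → Fin N
  sink_mem : ∀ e : graph.edgeSet, sink e ∈ (e : Sym2 (Fin N))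
  /-- the magnitude set-points -/
  vstar : Fin N → ℝ
  vstar_pos : ∀ k, 0 < vstar k
  /-- the phase set-points, relative to the first oscillator -/
  theta : Fin N → ℝ

/-- The planar rotation by the angle `θ`. -/
def rot (θ : ℝ) : Matrix (Fin 2) (Fin 2) ℝ :=
  !![Real.cos θ, -Real.sin θ; Real.sin θ, Real.cos θ]

namespace OscillatorNetwork

/-- The state space `ℝ^{2N}` with its Euclidean norm; `v (k, i)` is the `i`-th component of the
state of oscillator `k`. -/
abbrev State (N : ℕ) : Type := EuclideanSpace ℝ (Fin N × Fin 2)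

/-- The block `v_k ∈ ℝ²` of the state `v`. -/
def block {N : ℕ} (v : State N) (k : Fin N) : EuclideanSpace ℝ (Fin 2) :=
  WithLp.toLp 2 fun i => v (k, i)

/-- The block-diagonal matrix with the `2 × 2` blocks `A 0, …, A (N - 1)`. -/
def diagBlocks {N : ℕ} (A : Fin N → Matrix (Fin 2) (Fin 2) ℝ) :
    Matrix (Fin N × Fin 2) (Fin N × Fin 2) ℝ :=
  Matrix.of fun p q => if p.1 = q.1 then A p.1 p.2 q.2 else 0

variable {N : ℕ} (net : OscillatorNetwork N)

open Classical in
/-- The oriented incidence matrix `B`. -/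
def incidence : Matrix (Fin N) net.graph.edgeSet ℝ :=
  Matrix.of fun k e =>
    if k = net.sink e then 1 else if k ∈ (e : Sym2 (Fin N)) then -1 else 0

open Classical in
/-- The graph Laplacian `L = B diag(w) Bᵀ`. -/
def laplacian : Matrix (Fin N) (Fin N) ℝ :=
  net.incidence * Matrix.diagonal (fun e : net.graph.edgeSet => net.weight e) *
    net.incidence.transpose

/-- The extended Laplacian `𝓛 = L ⊗ I₂`. -/
def extLaplacian : Matrix (Fin N × Fin 2) (Fin N × Fin 2) ℝ :=
  net.laplacian ⊗ₖ (1 : Matrix (Fin 2) (Fin 2) ℝ)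

open Classical in
/-- `K_k = ∑_{j ∼ k} w_{jk} (I₂ - (v⋆_j / v⋆_k) R(θ⋆_j - θ⋆_k))`. -/
def gainBlock (k : Fin N) : Matrix (Fin 2) (Fin 2) ℝ :=
  ∑ j with net.graph.Adj j k, net.weight s(j, k) •
    (1 - (net.vstar j / net.vstar k) • rot (net.theta j - net.theta k))

/-- `𝓚 = diag(K_1, …, K_N)`. -/
def gain : Matrix (Fin N × Fin 2) (Fin N × Fin 2) ℝ :=
  diagBlocks net.gainBlock

/-- The scaled magnitude error `Φ_k(v_k) = (v⋆_k - ‖v_k‖) / v⋆_k`. -/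
def magError (k : Fin N) (x : EuclideanSpace ℝ (Fin 2)) : ℝ :=
  (net.vstar k - ‖x‖) / net.vstar k

/-- `Φ(v) = diag(Φ_1(v_1) I₂, …, Φ_N(v_N) I₂)`. -/
def magErrorMatrix (v : State N) : Matrix (Fin N × Fin 2) (Fin N × Fin 2) ℝ :=
  diagBlocks fun k => net.magError k (block v k) • 1

/-- The closed-loop vector field in the rotating frame,
`v ↦ η (𝓚 - 𝓛) v + α Φ(v) v`. -/
def rotatingField (η α : ℝ) (v : State N) : State N :=
  η • Matrix.toEuclideanCLM (𝕜 := ℝ) (net.gain - net.extLaplacian) v +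
    α • Matrix.toEuclideanCLM (𝕜 := ℝ) (net.magErrorMatrix v) v

end OscillatorNetwork

/-- `x` solves `dx/dt = f(x)` for all `t ≥ 0`, with `x(0) = x₀` (one-sided derivative at `0`). -/
def IsForwardSolution {E : Type*} [NormedAddCommGroup E] [NormedSpace ℝ E]
    (f : E → E) (x₀ : E) (x : ℝ → E) : Prop :=
  x 0 = x₀ ∧ IsIntegralCurveOn x (fun _ => f) (Ici 0)

/-- The value `φ_f(t, x₀)` at time `t` of the solution of `dx/dt = f(x)`, `x(0) = x₀`. Meaningful
for `t ≥ 0` when this problem has exactly one solution on `[0, ∞)`. -/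
def solutionMap {E : Type*} [NormedAddCommGroup E] [NormedSpace ℝ E]
    (f : E → E) (t : ℝ) (x₀ : E) : E :=
  Classical.epsilon (IsForwardSolution f x₀) t

/-- Stability of `dx/dt = f(x)` with respect to the set `C`. -/
def IsStableWrt {E : Type*} [NormedAddCommGroup E] [NormedSpace ℝ E]
    (f : E → E) (C : Set E) : Prop :=
  ∀ ε > 0, ∃ δ > 0, ∀ x₀ : E, Metric.infDist x₀ C < δ →
    ∀ t : ℝ, 0 ≤ t → Metric.infDist (solutionMap f t x₀) C < ε

/-- The set of initial conditions whose trajectories converge to the origin. -/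
def originBasin {E : Type*} [NormedAddCommGroup E] [NormedSpace ℝ E] (f : E → E) : Set E :=
  {x₀ | Tendsto (fun t => solutionMap f t x₀) atTop (𝓝 0)}

end

/-!
The field splits as `f = A + h`, where `A` is the Jacobian at the origin and `h` consists of the
blocks `-(α / v⋆_k) ‖v_k‖ v_k`. The perturbation `h` points inwards and has the Lipschitz bound of a
quadratic map. These two facts (`IsInwardPerturbation`) and one eigenvector of `A` with a positive
eigenvalue carry the argument.

*Global solutions.* Since `h` points inwards, the norm of a solution grows at most like
`exp (‖A‖ t)`. Cutting the field off outside a large ball makes it bounded and globally Lipschitz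
without affecting this estimate, so the Picard–Lindelöf theorem yields solutions on every `[0, T]`,
and uniqueness glues them.

*The eigenvector.* The gains `K_k` are such that the states with blocks `v⋆_k R(θ⋆_k) w`, for
`w ∈ ℝ²`, lie in the kernel of `𝓚 - 𝓛`. Hence `α` is an eigenvalue of `A` with an eigenspace of
dimension at least two, whatever the signs of the weights.

*Instability and the basin.* No stable manifold theorem is needed. For all but finitely many `s` in
`(0, α)` the Lyapunov equation `A* P + P A - 2 s P = 1` is solvable (`exists_lyapunov`), and
`V z = ⟪z, P z⟫` is then automatically positive at the eigenvector. Along the difference `z` of two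
trajectories in a small ball, `V' ≥ 2 s V`; if both trajectories remain in the ball for ever, then
`V` is bounded, so `V ≤ 0` at the initial difference (`lyapunov_nonpos_of_bounded`). Comparing with
the zero trajectory gives instability. Moreover the set `W` of initial conditions whose trajectories
remain in the ball satisfies `V (x - y) ≤ 0` for all its points, so the translates of its closure
along the eigenvector are disjoint and `W` is null. Every trajectory tending to the origin passes
through `W` at some integer time, and the time-`n` maps have locally Lipschitz inverses, so the basin
is a countable union of null sets.
-/

open scoped RealInnerProductSpace NNReal

section DissipativeFields

/-! ### Differential inequalities and solutions on compact intervals -/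

/-- Comparison principle: `V' ≥ c V` forces `V` to grow at least like `exp (c t)`. -/
lemma exp_mul_le_of_hasDerivWithinAt {V V' : ℝ → ℝ} {c T : ℝ} (hT : 0 ≤ T)
    (hV : ∀ t ∈ Icc 0 T, HasDerivWithinAt V (V' t) (Icc 0 T) t)
    (hc : ∀ t ∈ Icc 0 T, c * V t ≤ V' t) : Real.exp (c * T) * V 0 ≤ V T := by
  have hE (t : ℝ) : HasDerivAt (fun t => Real.exp (-c * t)) (Real.exp (-c * t) * (-c)) t := by
    simpa using ((hasDerivAt_id t).const_mul (-c)).exp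
  have hd : ∀ t ∈ Icc 0 T, HasDerivWithinAt (fun t => Real.exp (-c * t) * V t)
      (Real.exp (-c * t) * (-c) * V t + Real.exp (-c * t) * V' t) (Icc 0 T) t :=
    fun t ht => (hE t).hasDerivWithinAt.mul (hV t ht)
  have hmono : MonotoneOn (fun t => Real.exp (-c * t) * V t) (Icc 0 T) := by
    refine monotoneOn_of_hasDerivWithinAt_nonneg (convex_Icc 0 T)
      (fun t ht => (hd t ht).continuousWithinAt)
      (fun t ht => (hd t (interior_subset ht)).mono interior_subset) fun t ht => ?_
    have := mul_nonneg (Real.exp_pos (-c * t)).le (sub_nonneg.2 (hc t (interior_subset ht)))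
    linarith
  have h := hmono (left_mem_Icc.2 hT) (right_mem_Icc.2 hT) hT
  simp only [mul_zero, Real.exp_zero, one_mul] at h
  calc Real.exp (c * T) * V 0 ≤ Real.exp (c * T) * (Real.exp (-c * T) * V T) := by gcongr
    _ = V T := by rw [← mul_assoc, ← Real.exp_add]; simp

section RadialCutoff

variable {E : Type*} [NormedAddCommGroup E]

/-- A Lipschitz cutoff: equal to `1` on the ball of radius `R`, and to `0` outside the ball of
radius `R + 1`. -/
def radialCutoff (R : ℝ) (x : E) : ℝ := max 0 (min 1 (R + 1 - ‖x‖))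

lemma radialCutoff_nonneg (R : ℝ) (x : E) : 0 ≤ radialCutoff R x := le_max_left _ _

lemma radialCutoff_le_one (R : ℝ) (x : E) : radialCutoff R x ≤ 1 := by simp [radialCutoff]

lemma radialCutoff_eq_one {R : ℝ} {x : E} (h : ‖x‖ ≤ R) : radialCutoff R x = 1 := by
  rw [radialCutoff, min_eq_left (by linarith), max_eq_right zero_le_one]

lemma radialCutoff_eq_zero {R : ℝ} {x : E} (h : R + 1 ≤ ‖x‖) : radialCutoff R x = 0 := by
  rw [radialCutoff, max_eq_left (min_le_of_right_le (by linarith))]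

lemma abs_radialCutoff_sub_le (R : ℝ) (x y : E) :
    |radialCutoff R x - radialCutoff R y| ≤ ‖x - y‖ := by
  have h : LipschitzWith 1 (radialCutoff R : E → ℝ) := by
    have := ((LipschitzWith.const (R + 1)).sub (lipschitzWith_one_norm (E := E)))
    simp only [zero_add] at this
    exact (this.const_min 1).const_max 0
  simpa [dist_eq_norm] using h.dist_le_mul x y

end RadialCutoff

variable {E : Type*} [NormedAddCommGroup E] [InnerProductSpace ℝ E]

lemma IsIntegralCurveOn.hasDerivWithinAt_norm_sq {f : E → E} {x : ℝ → E} {s : Set ℝ}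
    (hx : IsIntegralCurveOn x (fun _ => f) s) {t : ℝ} (ht : t ∈ s) :
    HasDerivWithinAt (fun t => ‖x t‖ ^ 2) (2 * ⟪x t, f (x t)⟫) s t :=
  (hx t ht).norm_sq

/-- A field whose radial component is at most `a ‖x‖` lets the norm grow at most like
`exp (a t)`. -/
lemma IsIntegralCurveOn.norm_le_exp_mul {f : E → E} {x : ℝ → E} {a T : ℝ} (hT : 0 ≤ T)
    (hf : ∀ x, ⟪x, f x⟫ ≤ a * ‖x‖ ^ 2) (hx : IsIntegralCurveOn x (fun _ => f) (Icc 0 T)) :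
    ‖x T‖ ≤ Real.exp (a * T) * ‖x 0‖ := by
  have h := exp_mul_le_of_hasDerivWithinAt (c := 2 * a) hT
    (fun t ht => (hx.hasDerivWithinAt_norm_sq ht).neg)
    (fun t _ => by simp only [Pi.neg_apply]; linarith [hf (x t)])
  have he : Real.exp (2 * a * T) = Real.exp (a * T) ^ 2 := by rw [sq, ← Real.exp_add]; ring_nf
  refine le_of_sq_le_sq ?_ (by positivity)
  rw [mul_pow, ← he]
  simp only [Pi.neg_apply] at h
  linarith

/-- Two trajectories in a region where the field is `K`-Lipschitz neither separate nor approach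
each other faster than exponentially at rate `K`. -/
lemma IsIntegralCurveOn.dist_bounds {f : E → E} {s : Set E} {K : ℝ≥0} (hf : LipschitzOnWith K f s)
    {x y : ℝ → E} {T : ℝ} (hT : 0 ≤ T)
    (hx : IsIntegralCurveOn x (fun _ => f) (Icc 0 T)) (hy : IsIntegralCurveOn y (fun _ => f) (Icc 0 T))
    (hxs : ∀ t ∈ Icc 0 T, x t ∈ s) (hys : ∀ t ∈ Icc 0 T, y t ∈ s) :
    ‖x T - y T‖ ≤ Real.exp (K * T) * ‖x 0 - y 0‖ ∧
      ‖x 0 - y 0‖ ≤ Real.exp (K * T) * ‖x T - y T‖ := by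
  have hd : ∀ t ∈ Icc 0 T, HasDerivWithinAt (fun t => ‖x t - y t‖ ^ 2)
      (2 * ⟪x t - y t, f (x t) - f (y t)⟫) (Icc 0 T) t :=
    fun t ht => ((hx t ht).sub (hy t ht)).norm_sq
  have hb : ∀ t ∈ Icc 0 T, |⟪x t - y t, f (x t) - f (y t)⟫| ≤ K * ‖x t - y t‖ ^ 2 := by
    intro t ht
    calc _ ≤ ‖x t - y t‖ * ‖f (x t) - f (y t)‖ := abs_real_inner_le_norm _ _
      _ ≤ ‖x t - y t‖ * (K * ‖x t - y t‖) := by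
        gcongr; exact hf.norm_sub_le (hxs t ht) (hys t ht)
      _ = _ := by ring
  have he : Real.exp (2 * K * T) = Real.exp (K * T) ^ 2 := by rw [sq, ← Real.exp_add]; ring_nf
  have h1 := exp_mul_le_of_hasDerivWithinAt (c := 2 * K) hT (fun t ht => (hd t ht).neg)
    (fun t ht => by simp only [Pi.neg_apply]; linarith [(abs_le.1 (hb t ht)).2])
  have h2 := exp_mul_le_of_hasDerivWithinAt (c := -(2 * K)) hT hd
    (fun t ht => by linarith [(abs_le.1 (hb t ht)).1])
  simp only [Pi.neg_apply] at h1
  constructor <;> refine le_of_sq_le_sq ?_ (by positivity) <;> rw [mul_pow, ← he]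
  · linarith
  · rw [neg_mul, Real.exp_neg] at h2
    rwa [← div_le_iff₀' (Real.exp_pos _), div_eq_inv_mul]

/-- A bounded, globally Lipschitz field has a solution on `[0, T]` for every `T`: the Picard–Lindelöf
theorem applies on a ball so large that no solution can leave it before time `T`. -/
lemma exists_isIntegralCurveOn_Icc_of_bounded [CompleteSpace E] {f : E → E} {K L : ℝ≥0}
    (hK : LipschitzWith K f) (hL : ∀ x, ‖f x‖ ≤ L) (T : ℝ≥0) (x₀ : E) :
    ∃ x : ℝ → E, x 0 = x₀ ∧ IsIntegralCurveOn x (fun _ => f) (Icc 0 T) := by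
  have hpl : IsPicardLindelof (fun _ => f) (tmin := 0) (tmax := T) ⟨0, by simp⟩ x₀ (L * T) 0 L K :=
    .of_time_independent (fun x _ => hL x) hK.lipschitzOnWith (by simp)
  exact hpl.exists_eq_forall_mem_Icc_hasDerivWithinAt₀

lemma lipschitzWith_radialCutoff_smul {f : E → E} {R : ℝ} {K M : ℝ≥0}
    (hf : LipschitzOnWith K f (Metric.closedBall 0 (R + 1)))
    (hM : ∀ x ∈ Metric.closedBall (0 : E) (R + 1), ‖f x‖ ≤ M) :
    LipschitzWith (K + M) fun x => radialCutoff R x • f x := by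
  -- it suffices to treat pairs whose first point lies in the support of the cutoff
  have key : ∀ x y : E, ‖x‖ ≤ R + 1 →
      ‖radialCutoff R x • f x - radialCutoff R y • f y‖ ≤ (K + M) * ‖x - y‖ := by
    intro x y hx
    have hx' : x ∈ Metric.closedBall (0 : E) (R + 1) := by simpa using hx
    have h1 : ‖(radialCutoff R x - radialCutoff R y) • f x‖ ≤ ‖x - y‖ * M := by
      rw [norm_smul]
      exact mul_le_mul (abs_radialCutoff_sub_le R x y) (hM x hx') (norm_nonneg _) (norm_nonneg _)
    have h2 : ‖radialCutoff R y • (f x - f y)‖ ≤ K * ‖x - y‖ := by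
      rcases le_total ‖y‖ (R + 1) with hy | hy
      · rw [norm_smul, Real.norm_of_nonneg (radialCutoff_nonneg R y)]
        exact (mul_le_of_le_one_left (norm_nonneg _) (radialCutoff_le_one R y)).trans
          (hf.norm_sub_le hx' (by simpa using hy))
      · simp only [radialCutoff_eq_zero hy, zero_smul, norm_zero]; positivity
    calc _ = ‖(radialCutoff R x - radialCutoff R y) • f x + radialCutoff R y • (f x - f y)‖ := by
          congr 1; module
      _ ≤ _ := (norm_add_le _ _).trans (by linarith)
  refine LipschitzWith.of_dist_le_mul fun x y => ?_
  rw [dist_eq_norm, dist_eq_norm, NNReal.coe_add]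
  rcases le_total ‖x‖ (R + 1) with hx | hx
  · exact key x y hx
  rcases le_total ‖y‖ (R + 1) with hy | hy
  · rw [norm_sub_rev, norm_sub_rev x]; exact key y x hy
  · simp only [radialCutoff_eq_zero hx, radialCutoff_eq_zero hy, zero_smul, sub_self, norm_zero]
    positivity

/-- The a priori estimate together with a Lipschitz bound on every ball gives solutions on `[0, T]`
for every `T`: a cut-off field obeys the same a priori estimate, so its solution never sees the
cutoff. -/
lemma exists_isIntegralCurveOn_Icc [CompleteSpace E] {f : E → E} {a : ℝ} (ha : 0 ≤ a)
    (hlip : ∀ R : ℝ, ∃ K : ℝ≥0, LipschitzOnWith K f (Metric.closedBall 0 R))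
    (hf : ∀ x, ⟪x, f x⟫ ≤ a * ‖x‖ ^ 2) (T : ℝ≥0) (x₀ : E) :
    ∃ x : ℝ → E, x 0 = x₀ ∧ IsIntegralCurveOn x (fun _ => f) (Icc 0 T) := by
  set R : ℝ := Real.exp (a * T) * ‖x₀‖ with hR
  have hR0 : 0 ≤ R := by positivity
  obtain ⟨K, hK⟩ := hlip (R + 1)
  have hM : ∀ x ∈ Metric.closedBall (0 : E) (R + 1),
      ‖f x‖ ≤ (‖f 0‖₊ + K * ⟨R + 1, by positivity⟩ : ℝ≥0) := by
    intro x hx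
    have h := hK.norm_sub_le hx (Metric.mem_closedBall_self (by positivity))
    rw [sub_zero] at h
    have hx' : ‖x‖ ≤ R + 1 := by simpa using hx
    calc ‖f x‖ ≤ ‖f 0‖ + ‖f x - f 0‖ := norm_le_norm_add_norm_sub' _ _
      _ ≤ ‖f 0‖ + K * (R + 1) := by gcongr; exact h.trans (by gcongr)
  obtain ⟨x, hx0, hx⟩ := exists_isIntegralCurveOn_Icc_of_bounded
    (lipschitzWith_radialCutoff_smul hK hM) (L := ‖f 0‖₊ + K * ⟨R + 1, by positivity⟩)
    (fun x => by
      rcases le_total ‖x‖ (R + 1) with h | h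
      · rw [norm_smul, Real.norm_of_nonneg (radialCutoff_nonneg R x)]
        exact (mul_le_of_le_one_left (norm_nonneg _) (radialCutoff_le_one R x)).trans
          (hM x (by simpa using h))
      · simp only [radialCutoff_eq_zero h, zero_smul, norm_zero]; positivity) T x₀
  refine ⟨x, hx0, fun t ht => ?_⟩
  have hxt : ‖x t‖ ≤ R := by
    have h := (hx.mono (Icc_subset_Icc_right ht.2)).norm_le_exp_mul (a := a) ht.1 fun y => by
      rw [inner_smul_right]
      calc radialCutoff R y * ⟪y, f y⟫ ≤ radialCutoff R y * (a * ‖y‖ ^ 2) :=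
            mul_le_mul_of_nonneg_left (hf y) (radialCutoff_nonneg R y)
        _ ≤ a * ‖y‖ ^ 2 := mul_le_of_le_one_left (by positivity) (radialCutoff_le_one R y)
    rw [hx0] at h
    exact h.trans (by rw [hR]; gcongr; exact ht.2)
  simpa [radialCutoff_eq_one hxt] using hx t ht

/-! ### Forward completeness -/

/-- A field that is Lipschitz on every ball and whose radial component is at most `a ‖x‖`. Such a
field is forward complete, although solutions may blow up in backward time. -/
structure IsRadiallyBounded (f : E → E) (a : ℝ) : Prop where
  nonneg : 0 ≤ a
  lipschitz : ∀ R : ℝ, ∃ K : ℝ≥0, LipschitzOnWith K f (Metric.closedBall 0 R)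
  inner_le : ∀ x, ⟪x, f x⟫ ≤ a * ‖x‖ ^ 2

lemma IsForwardSolution.isIntegralCurveOn_Icc {f : E → E} {x₀ : E} {x : ℝ → E}
    (hx : IsForwardSolution f x₀ x) (T : ℝ) : IsIntegralCurveOn x (fun _ => f) (Icc 0 T) :=
  hx.2.mono Icc_subset_Ici_self

lemma IsForwardSolution.shift {f : E → E} {x₀ : E} {x : ℝ → E} (hx : IsForwardSolution f x₀ x)
    {s : ℝ} (hs : 0 ≤ s) : IsForwardSolution f (x s) fun t => x (t + s) := by
  refine ⟨by simp, fun t ht => ?_⟩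
  have h := hx.2 (t + s) (add_nonneg ht hs)
  have hadd : HasDerivWithinAt (fun t : ℝ => t + s) 1 (Ici 0) t :=
    ((hasDerivAt_id t).add_const s).hasDerivWithinAt
  simpa [Function.comp_def] using h.scomp t hadd fun r hr => add_nonneg hr hs

namespace IsRadiallyBounded

variable {f : E → E} {a : ℝ}

lemma norm_le (hf : IsRadiallyBounded f a) {x : ℝ → E} {t T : ℝ} (ht : t ∈ Icc 0 T)
    (hx : IsIntegralCurveOn x (fun _ => f) (Icc 0 T)) : ‖x t‖ ≤ Real.exp (a * T) * ‖x 0‖ := by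
  refine ((hx.mono (Icc_subset_Icc_right ht.2)).norm_le_exp_mul ht.1 hf.inner_le).trans ?_
  have := mul_le_mul_of_nonneg_left ht.2 hf.nonneg
  gcongr

/-- On bounded sets of initial conditions, the time-`T` map and its inverse are Lipschitz. -/
lemma exists_dist_bounds (hf : IsRadiallyBounded f a) {T : ℝ} (hT : 0 ≤ T) (M : ℝ) :
    ∃ K : ℝ≥0, ∀ x y : ℝ → E, IsIntegralCurveOn x (fun _ => f) (Icc 0 T) →
      IsIntegralCurveOn y (fun _ => f) (Icc 0 T) → ‖x 0‖ ≤ M → ‖y 0‖ ≤ M →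
      ‖x T - y T‖ ≤ K * ‖x 0 - y 0‖ ∧ ‖x 0 - y 0‖ ≤ K * ‖x T - y T‖ := by
  obtain ⟨K, hK⟩ := hf.lipschitz (Real.exp (a * T) * M)
  refine ⟨⟨Real.exp (K * T), (Real.exp_pos _).le⟩, fun x y hx hy hxM hyM => ?_⟩
  exact hx.dist_bounds hK hT hy
    (fun t ht => by simpa using (hf.norm_le ht hx).trans (by gcongr))
    (fun t ht => by simpa using (hf.norm_le ht hy).trans (by gcongr))

lemma eqOn_Icc (hf : IsRadiallyBounded f a) {T : ℝ} {x y : ℝ → E}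
    (hx : IsIntegralCurveOn x (fun _ => f) (Icc 0 T))
    (hy : IsIntegralCurveOn y (fun _ => f) (Icc 0 T)) (h0 : x 0 = y 0) : EqOn x y (Icc 0 T) := by
  intro t ht
  obtain ⟨K, hK⟩ := hf.exists_dist_bounds ht.1 ‖x 0‖
  have h := (hK x y (hx.mono (Icc_subset_Icc_right ht.2)) (hy.mono (Icc_subset_Icc_right ht.2))
    le_rfl (by rw [h0])).1
  rw [h0, sub_self, norm_zero, mul_zero] at h
  exact sub_eq_zero.1 (norm_le_zero_iff.1 h)

lemma exists_isForwardSolution [CompleteSpace E] (hf : IsRadiallyBounded f a) (x₀ : E) :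
    ∃ x, IsForwardSolution f x₀ x := by
  choose X hX0 hX using fun n : ℕ => exists_isIntegralCurveOn_Icc hf.nonneg hf.lipschitz
    hf.inner_le n x₀
  have hmono {m n : ℕ} {t : ℝ} (ht0 : 0 ≤ t) (hm : t ≤ m) (hn : t ≤ n) : X m t = X n t :=
    hf.eqOn_Icc ((hX m).mono (Icc_subset_Icc_right (by simpa using hm)))
      ((hX n).mono (Icc_subset_Icc_right (by simpa using hn))) ((hX0 m).trans (hX0 n).symm)
      (right_mem_Icc.2 ht0)
  -- at time `t`, use the solution on `[0, ⌈t⌉ + 1]`, whose domain contains times beyond `t`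
  have hc (t : ℝ) : t < (⌈t⌉₊ + 1 : ℕ) := by push_cast; linarith [Nat.le_ceil t]
  refine ⟨fun t => X (⌈t⌉₊ + 1) t, hX0 _, fun t ht => ?_⟩
  have ht : 0 ≤ t := ht
  set n := ⌈t⌉₊ + 1 with hn
  have hnhds : Icc 0 (n : ℝ) ∈ 𝓝[Ici 0] t :=
    inter_mem_nhdsWithin (Ici 0) (Iic_mem_nhds (hc t))
  refine ((hX n t ⟨ht, (hc t).le⟩).mono_of_mem_nhdsWithin hnhds).congr_of_eventuallyEq ?_ rfl
  filter_upwards [hnhds] with s hs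
  exact hmono hs.1 (hc s).le hs.2

lemma isForwardSolution_solutionMap [CompleteSpace E] (hf : IsRadiallyBounded f a) (x₀ : E) :
    IsForwardSolution f x₀ fun t => solutionMap f t x₀ :=
  Classical.epsilon_spec (hf.exists_isForwardSolution x₀)

lemma eq_of_isForwardSolution (hf : IsRadiallyBounded f a) {x₀ : E} {x y : ℝ → E}
    (hx : IsForwardSolution f x₀ x) (hy : IsForwardSolution f x₀ y) {t : ℝ} (ht : 0 ≤ t) :
    x t = y t :=
  hf.eqOn_Icc (hx.isIntegralCurveOn_Icc t) (hy.isIntegralCurveOn_Icc t) (hx.1.trans hy.1.symm)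
    (right_mem_Icc.2 ht)

end IsRadiallyBounded

/-! ### Quadratic forms growing along differences of trajectories, and null sets -/

/-- For some `s ∈ (0, α)` the Lyapunov equation `A* P + P A - 2 s P = 1` has a solution: the
operator `P ↦ A* P + P A` has only finitely many eigenvalues, so `2 s` can be chosen to avoid
them. -/
lemma exists_lyapunov [FiniteDimensional ℝ E] (A : E →L[ℝ] E) {α : ℝ} (hα : 0 < α) :
    ∃ s ∈ Ioo 0 α, ∃ P : E →L[ℝ] E,
      ∀ z, ⟪A z, P z⟫ + ⟪z, P (A z)⟫ = 2 * s * ⟪z, P z⟫ + ‖z‖ ^ 2 := by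
  let T : Module.End ℝ (Module.End ℝ E) :=
    LinearMap.mulLeft ℝ (LinearMap.adjoint (A : E →ₗ[ℝ] E)) + LinearMap.mulRight ℝ (A : E →ₗ[ℝ] E)
  obtain ⟨c, hc, hcT⟩ := (Ioo_infinite (show (0 : ℝ) < 2 * α by linarith)).exists_notMem_finite
    T.finite_hasEigenvalue
  have hinj : LinearMap.ker (T - algebraMap ℝ _ c) = ⊥ := by
    have h : ¬ T.HasEigenvalue c := hcT
    rwa [Module.End.hasEigenvalue_iff, not_not, Module.End.eigenspace_def] at h
  obtain ⟨P, hP⟩ := LinearMap.range_eq_top.1 (LinearMap.ker_eq_bot_iff_range_eq_top.1 hinj) 1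
  refine ⟨c / 2, ⟨by linarith [hc.1], by linarith [hc.2]⟩, LinearMap.toContinuousLinearMap P,
    fun z => ?_⟩
  have h := congrArg (fun Q : Module.End ℝ E => ⟪z, Q z⟫) hP
  simp only [T, LinearMap.sub_apply, LinearMap.add_apply, LinearMap.mulLeft_apply,
    LinearMap.mulRight_apply, Module.End.mul_apply, Module.algebraMap_end_apply, inner_sub_right,
    inner_add_right, LinearMap.adjoint_inner_right, LinearMap.smul_apply, inner_smul_right,
    Module.End.one_apply, real_inner_self_eq_norm_sq, ContinuousLinearMap.coe_coe] at h
  simp only [LinearMap.coe_toContinuousLinearMap']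
  linarith

/-- The quadratic form of the Lyapunov equation is positive on eigenvectors of `A` whose eigenvalue
exceeds `s`. -/
lemma lyapunov_pos_of_eigenvector {A P : E →L[ℝ] E} {s α : ℝ} (hs : s < α)
    (hP : ∀ z, ⟪A z, P z⟫ + ⟪z, P (A z)⟫ = 2 * s * ⟪z, P z⟫ + ‖z‖ ^ 2)
    {u : E} (hu : u ≠ 0) (hAu : A u = α • u) : 0 < ⟪u, P u⟫ := by
  have h := hP u
  rw [hAu, map_smul, real_inner_smul_left, real_inner_smul_right] at h
  have hpos : 0 < ‖u‖ ^ 2 := by positivity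
  have : 0 < 2 * (α - s) * ⟪u, P u⟫ := by linarith
  exact pos_of_mul_pos_right this (by linarith)

/-- Two trajectories that remain for ever in a small ball have a difference on which the Lyapunov
form is nonpositive; otherwise the form would grow exponentially along the difference. -/
lemma lyapunov_nonpos_of_bounded {A P : E →L[ℝ] E} {s ε r : ℝ} (hs : 0 < s)
    (hP : ∀ z, ⟪A z, P z⟫ + ⟪z, P (A z)⟫ = 2 * s * ⟪z, P z⟫ + ‖z‖ ^ 2)
    {f : E → E} (hεP : 2 * ε * ‖P‖ ≤ 1)
    (hf : ∀ x ∈ Metric.closedBall (0 : E) r, ∀ y ∈ Metric.closedBall (0 : E) r,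
      ‖f x - f y - A (x - y)‖ ≤ ε * ‖x - y‖)
    {x₀ y₀ : E} {x y : ℝ → E} (hx : IsForwardSolution f x₀ x) (hy : IsForwardSolution f y₀ y)
    (hxr : ∀ t, 0 ≤ t → x t ∈ Metric.closedBall (0 : E) r)
    (hyr : ∀ t, 0 ≤ t → y t ∈ Metric.closedBall (0 : E) r) : ⟪x₀ - y₀, P (x₀ - y₀)⟫ ≤ 0 := by
  by_contra! hpos
  have hgrowth : ∀ T : ℝ, 0 ≤ T →
      Real.exp (2 * s * T) * ⟪x₀ - y₀, P (x₀ - y₀)⟫ ≤ ⟪x T - y T, P (x T - y T)⟫ := by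
    intro T hT
    have hd : ∀ t ∈ Icc 0 T, HasDerivWithinAt (fun t => ⟪x t - y t, P (x t - y t)⟫)
        (⟪x t - y t, P (f (x t) - f (y t))⟫ + ⟪f (x t) - f (y t), P (x t - y t)⟫) (Icc 0 T) t := by
      intro t ht
      have hz := (hx.isIntegralCurveOn_Icc T t ht).sub (hy.isIntegralCurveOn_Icc T t ht)
      exact hz.inner ℝ (P.hasFDerivAt.comp_hasDerivWithinAt t hz)
    have h := exp_mul_le_of_hasDerivWithinAt (c := 2 * s) hT hd
      (fun t ht => by
        -- the second-order error `w` is absorbed by the term `‖z‖ ^ 2` of the Lyapunov equation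
        have hε := hf _ (hxr t ht.1) _ (hyr t ht.1)
        set z := x t - y t
        set w := f (x t) - f (y t) - A z with hw
        have hfw : f (x t) - f (y t) = A z + w := by rw [hw]; abel
        have h1 : |⟪w, P z⟫| ≤ ε * ‖z‖ * (‖P‖ * ‖z‖) :=
          (abs_real_inner_le_norm _ _).trans
            (mul_le_mul hε (P.le_opNorm z) (norm_nonneg _) ((norm_nonneg _).trans hε))
        have h2 : |⟪z, P w⟫| ≤ ‖z‖ * (‖P‖ * (ε * ‖z‖)) :=
          (abs_real_inner_le_norm _ _).trans (by gcongr; exact P.le_opNorm_of_le hε)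
        have h3 : 2 * ε * ‖P‖ * ‖z‖ ^ 2 ≤ 1 * ‖z‖ ^ 2 := by gcongr
        rw [hfw, map_add, inner_add_left, inner_add_right]
        have := hP z
        have := (abs_le.1 h1).1
        have := (abs_le.1 h2).1
        nlinarith)
    simpa only [hx.1, hy.1] using h
  have hbdd : ∀ T : ℝ, 0 ≤ T → ⟪x T - y T, P (x T - y T)⟫ ≤ 2 * r * (‖P‖ * (2 * r)) := by
    intro T hT
    have hz : ‖x T - y T‖ ≤ 2 * r := by
      have h1 : ‖x T‖ ≤ r := by simpa using hxr T hT
      have h2 : ‖y T‖ ≤ r := by simpa using hyr T hT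
      linarith [norm_sub_le (x T) (y T)]
    exact (real_inner_le_norm _ _).trans (mul_le_mul hz (P.le_opNorm_of_le hz) (norm_nonneg _)
      ((norm_nonneg _).trans hz))
  have hlim : Tendsto (fun T => Real.exp (2 * s * T) * ⟪x₀ - y₀, P (x₀ - y₀)⟫) atTop atTop :=
    (Real.tendsto_exp_atTop.comp (tendsto_id.const_mul_atTop (by linarith))).atTop_mul_const hpos
  obtain ⟨T, hT, hT0⟩ := ((hlim.eventually_gt_atTop (2 * r * (‖P‖ * (2 * r)))).and
    (eventually_ge_atTop 0)).exists
  linarith [hgrowth T hT0, hbdd T hT0]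

/-- If a quadratic form is nonpositive on all differences of points of `W` and positive at some
vector `u`, then `W` is null: the translates of its closure by multiples of `u` are disjoint. -/
lemma measure_zero_of_quadratic_nonpos [FiniteDimensional ℝ E] [MeasurableSpace E] [BorelSpace E]
    (μ : Measure E) [μ.IsAddHaarMeasure] {P : E →L[ℝ] E} {u : E} (hu : 0 < ⟪u, P u⟫) {W : Set E}
    (hW : ∀ x ∈ W, ∀ y ∈ W, ⟪x - y, P (x - y)⟫ ≤ 0) : μ W = 0 := by
  refine measure_mono_null subset_closure (Measure.addHaar_eq_zero_of_disjoint_translates μ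
    (fun n : ℕ => (1 / ((n : ℝ) + 1)) • u) ?_ ?_ isClosed_closure.measurableSet)
  · have : Tendsto (fun n : ℕ => (1 / ((n : ℝ) + 1)) • u) atTop (𝓝 ((0 : ℝ) • u)) :=
      tendsto_one_div_add_atTop_nhds_zero_nat.smul_const u
    exact Metric.isBounded_range_of_tendsto _ this
  · have hcl : ∀ x ∈ closure W, ∀ y ∈ closure W, ⟪x - y, P (x - y)⟫ ≤ 0 := by
      intro x hx y hy
      have hcont : Continuous fun p : E × E => ⟪p.1 - p.2, P (p.1 - p.2)⟫ := by fun_prop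
      have hsub : closure (W ×ˢ W) ⊆ {p : E × E | ⟪p.1 - p.2, P (p.1 - p.2)⟫ ≤ 0} :=
        closure_minimal (fun p hp => hW _ hp.1 _ hp.2) (isClosed_le hcont continuous_const)
      exact hsub (by rw [closure_prod_eq]; exact ⟨hx, hy⟩ : (x, y) ∈ closure (W ×ˢ W))
    intro m n hmn
    rw [Function.onFun, Set.disjoint_left]
    rintro _ ⟨_, rfl, p, hp, rfl⟩ ⟨_, rfl, q, hq, hpq⟩
    have hne : (1 / ((m : ℝ) + 1)) - 1 / ((n : ℝ) + 1) ≠ 0 := by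
      intro h
      rw [sub_eq_zero, one_div, one_div, inv_inj] at h
      exact hmn (by exact_mod_cast add_right_cancel h)
    have hd : q - p = ((1 / ((m : ℝ) + 1)) - 1 / ((n : ℝ) + 1)) • u := by
      rw [sub_smul, sub_eq_sub_iff_add_eq_add, add_comm q]
      simp only at hpq
      rw [hpq]
    have h := hcl q hq p hp
    rw [hd, map_smul, real_inner_smul_left, real_inner_smul_right, ← mul_assoc] at h
    exact h.not_gt (mul_pos (mul_self_pos.2 hne) hu)

/-- A map with Lipschitz inverse on `S` reflects null sets. -/
lemma measure_zero_of_image_of_antilipschitzOn [FiniteDimensional ℝ E] [MeasurableSpace E]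
    [BorelSpace E] (μ : Measure E) [μ.IsAddHaarMeasure] {S : Set E} {g : E → E} {K : ℝ≥0}
    (hg : ∀ x ∈ S, ∀ y ∈ S, ‖x - y‖ ≤ K * ‖g x - g y‖) (h0 : μ (g '' S) = 0) : μ S = 0 := by
  set ν : Measure E := Measure.hausdorffMeasure (Module.finrank ℝ E)
  have hμν : μ ≪ ν := Measure.absolutelyContinuous_isAddHaarMeasure μ ν
  have hνμ : ν ≪ μ := Measure.absolutelyContinuous_isAddHaarMeasure ν μ
  have hinj : InjOn g S := by
    intro x hx y hy hxy
    have h := hg x hx y hy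
    rw [hxy, sub_self, norm_zero, mul_zero] at h
    exact sub_eq_zero.1 (norm_le_zero_iff.1 h)
  have hlip : LipschitzOnWith K (Function.invFunOn g S) (g '' S) := by
    refine LipschitzOnWith.of_dist_le_mul ?_
    rintro _ ⟨x, hx, rfl⟩ _ ⟨y, hy, rfl⟩
    rw [hinj.leftInvOn_invFunOn hx, hinj.leftInvOn_invFunOn hy, dist_eq_norm, dist_eq_norm]
    exact hg x hx y hy
  have h := hlip.hausdorffMeasure_image_le (d := Module.finrank ℝ E) (Nat.cast_nonneg _)
  rw [hinj.invFunOn_image Subset.rfl, hνμ h0, mul_zero] at h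
  exact hμν (nonpos_iff_eq_zero.1 h)

/-! ### Instability and the basin of the origin for `f = A + h` -/

/-- `f = A + h`, where `h` vanishes to second order at the origin, with the Lipschitz bound of a
quadratic map, and points inwards. -/
structure IsInwardPerturbation (f : E → E) (A : E →L[ℝ] E) (C : ℝ) : Prop where
  nonneg : 0 ≤ C
  map_zero : f 0 = 0
  norm_sub_le : ∀ x y, ‖f x - f y - A (x - y)‖ ≤ C * (‖x‖ + ‖y‖) * ‖x - y‖
  inner_le : ∀ x, ⟪x, f x⟫ ≤ ⟪x, A x⟫

namespace IsInwardPerturbation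

variable {f : E → E} {A : E →L[ℝ] E} {C : ℝ}

lemma norm_sub_le_of_mem_closedBall (hf : IsInwardPerturbation f A C) {r : ℝ} :
    ∀ x ∈ Metric.closedBall (0 : E) r, ∀ y ∈ Metric.closedBall (0 : E) r,
      ‖f x - f y - A (x - y)‖ ≤ 2 * C * r * ‖x - y‖ := by
  intro x hx y hy
  have hx : ‖x‖ ≤ r := by simpa using hx
  have hy : ‖y‖ ≤ r := by simpa using hy
  have := mul_le_mul_of_nonneg_left (add_le_add hx hy) hf.nonneg
  exact (hf.norm_sub_le x y).trans (mul_le_mul_of_nonneg_right (by linarith) (norm_nonneg _))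

lemma isRadiallyBounded (hf : IsInwardPerturbation f A C) : IsRadiallyBounded f ‖A‖ where
  nonneg := norm_nonneg A
  lipschitz R := by
    refine ⟨(2 * C * R + ‖A‖).toNNReal, LipschitzOnWith.of_dist_le_mul fun x hx y hy => ?_⟩
    rw [dist_eq_norm, dist_eq_norm]
    have h1 := hf.norm_sub_le_of_mem_closedBall x hx y hy
    have h2 := A.le_opNorm (x - y)
    calc ‖f x - f y‖ ≤ ‖f x - f y - A (x - y)‖ + ‖A (x - y)‖ := by
          simpa using norm_add_le (f x - f y - A (x - y)) (A (x - y))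
      _ ≤ (2 * C * R + ‖A‖) * ‖x - y‖ := by linarith
      _ ≤ _ := by gcongr; exact Real.le_coe_toNNReal _
  inner_le x := (hf.inner_le x).trans <| (real_inner_le_norm _ _).trans <| by
    have := mul_le_mul_of_nonneg_left (A.le_opNorm x) (norm_nonneg x)
    linarith

lemma hasFDerivAt (hf : IsInwardPerturbation f A C) : HasFDerivAt f A 0 := by
  rw [hasFDerivAt_iff_isLittleO_nhds_zero]
  have hO : (fun h => f (0 + h) - f 0 - A h) =O[𝓝 0] fun h : E => ‖h‖ ^ 2 := by
    refine Asymptotics.IsBigO.of_bound C (Eventually.of_forall fun h => ?_)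
    have := hf.norm_sub_le h 0
    simp only [sub_zero, norm_zero, add_zero] at this
    rw [zero_add, Real.norm_of_nonneg (by positivity)]
    linarith
  exact hO.trans_isLittleO (Asymptotics.isLittleO_norm_pow_id one_lt_two)

lemma isForwardSolution_zero (hf : IsInwardPerturbation f A C) :
    IsForwardSolution f 0 fun _ => 0 :=
  ⟨rfl, fun t _ => by simpa [hf.map_zero] using hasDerivWithinAt_const t (Ici 0) (0 : E)⟩

/-- A real eigenvector `u` with positive eigenvalue yields a quadratic form that is positive at `u`
but nonpositive on the difference of any two initial conditions whose trajectories remain in a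
certain ball around the origin. -/
lemma exists_separating_form [FiniteDimensional ℝ E] (hf : IsInwardPerturbation f A C) {α : ℝ}
    (hα : 0 < α) {u : E} (hu : u ≠ 0) (hAu : A u = α • u) :
    ∃ r > 0, ∃ P : E →L[ℝ] E, 0 < ⟪u, P u⟫ ∧ ∀ x₀ y₀ : E, ∀ x y : ℝ → E,
      IsForwardSolution f x₀ x → IsForwardSolution f y₀ y →
      (∀ t, 0 ≤ t → x t ∈ Metric.closedBall (0 : E) r) →
      (∀ t, 0 ≤ t → y t ∈ Metric.closedBall (0 : E) r) → ⟪x₀ - y₀, P (x₀ - y₀)⟫ ≤ 0 := by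
  obtain ⟨s, hs, P, hP⟩ := exists_lyapunov A hα
  have hC := hf.nonneg
  have hr : 0 < 4 * C * ‖P‖ + 1 := by positivity
  refine ⟨1 / (4 * C * ‖P‖ + 1), by positivity, P, lyapunov_pos_of_eigenvector hs.2 hP hu hAu,
    fun x₀ y₀ x y hx hy hxr hyr => lyapunov_nonpos_of_bounded hs.1 hP ?_
      hf.norm_sub_le_of_mem_closedBall hx hy hxr hyr⟩
  calc 2 * (2 * C * (1 / (4 * C * ‖P‖ + 1))) * ‖P‖ = 4 * C * ‖P‖ / (4 * C * ‖P‖ + 1) := by ring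
    _ ≤ 1 := (div_le_one hr).2 (by linarith)

lemma not_isStableWrt [FiniteDimensional ℝ E] (hf : IsInwardPerturbation f A C) {α : ℝ}
    (hα : 0 < α) {u : E} (hu : u ≠ 0) (hAu : A u = α • u) : ¬ IsStableWrt f {0} := by
  intro hstable
  obtain ⟨r, hr, P, hPu, hP⟩ := hf.exists_separating_form hα hu hAu
  obtain ⟨δ, hδ, hball⟩ := hstable r hr
  simp only [Metric.infDist_singleton, dist_zero_right] at hball
  have hu' : 0 < ‖u‖ := norm_pos_iff.2 hu
  set c := δ / (2 * ‖u‖) with hc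
  have hc0 : 0 < c := by positivity
  have hcu : ‖c • u‖ < δ := by
    rw [norm_smul, Real.norm_of_nonneg hc0.le, hc]
    field_simp
    linarith
  have h := hP (c • u) 0 _ _ (hf.isRadiallyBounded.isForwardSolution_solutionMap (c • u))
    hf.isForwardSolution_zero (fun t ht => by simpa using (hball _ hcu t ht).le)
    (fun _ _ => Metric.mem_closedBall_self hr.le)
  rw [sub_zero, map_smul, real_inner_smul_left, real_inner_smul_right] at h
  exact h.not_gt (by positivity)

/-- A trajectory tending to the origin eventually remains in a given ball, so at some integer time
it passes through the null set of initial conditions whose trajectories remain there; the time-`n`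
maps are invertible with locally Lipschitz inverse, so they reflect null sets. -/
lemma measure_originBasin [FiniteDimensional ℝ E] [MeasurableSpace E] [BorelSpace E]
    (μ : Measure E) [μ.IsAddHaarMeasure] (hf : IsInwardPerturbation f A C) {α : ℝ}
    (hα : 0 < α) {u : E} (hu : u ≠ 0) (hAu : A u = α • u) : μ (originBasin f) = 0 := by
  obtain ⟨r, hr, P, hPu, hP⟩ := hf.exists_separating_form hα hu hAu
  have hrad := hf.isRadiallyBounded
  set W : Set E := {x₀ | ∃ x, IsForwardSolution f x₀ x ∧
    ∀ t, 0 ≤ t → x t ∈ Metric.closedBall (0 : E) r}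
  have hW : μ W = 0 := measure_zero_of_quadratic_nonpos μ hPu <| by
    rintro x₀ ⟨x, hx, hxr⟩ y₀ ⟨y, hy, hyr⟩
    exact hP x₀ y₀ x y hx hy hxr hyr
  set S : ℕ → ℕ → Set E := fun n m => {x₀ | ‖x₀‖ ≤ m ∧ solutionMap f n x₀ ∈ W}
  have hnull (n m : ℕ) : μ (S n m) = 0 := by
    obtain ⟨K, hK⟩ := hrad.exists_dist_bounds (Nat.cast_nonneg n) m
    refine measure_zero_of_image_of_antilipschitzOn μ (g := solutionMap f n) (K := K) ?_
      (measure_mono_null (image_subset_iff.2 fun x (hx : x ∈ S n m) => mem_preimage.2 hx.2) hW)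
    intro x hx y hy
    have hxs := hrad.isForwardSolution_solutionMap x
    have hys := hrad.isForwardSolution_solutionMap y
    have hx0 : solutionMap f 0 x = x := hxs.1
    have hy0 : solutionMap f 0 y = y := hys.1
    have h := (hK _ _ (hxs.isIntegralCurveOn_Icc n) (hys.isIntegralCurveOn_Icc n)
      (hx0.symm ▸ hx.1) (hy0.symm ▸ hy.1)).2
    simpa only [hx0, hy0] using h
  refine measure_mono_null ?_ (measure_iUnion_null fun n => measure_iUnion_null (hnull n))
  intro x₀ hx₀
  have hx₀ : Tendsto (fun t => solutionMap f t x₀) atTop (𝓝 0) := hx₀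
  obtain ⟨t₀, ht₀⟩ := eventually_atTop.1 (hx₀.eventually (Metric.closedBall_mem_nhds 0 hr))
  obtain ⟨n, hn⟩ := exists_nat_ge t₀
  obtain ⟨m, hm⟩ := exists_nat_ge ‖x₀‖
  refine mem_iUnion.2 ⟨n, mem_iUnion.2 ⟨m, hm, fun t => solutionMap f (t + n) x₀,
    (hrad.isForwardSolution_solutionMap x₀).shift (Nat.cast_nonneg n), fun t ht => ?_⟩⟩
  exact ht₀ _ (by linarith)

end IsInwardPerturbation

end DissipativeFields

/-! ### The oscillator network -/

lemma rot_mul_rot (θ φ : ℝ) : rot θ * rot φ = rot (θ + φ) := by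
  ext i j
  fin_cases i <;> fin_cases j <;> simp [rot, Matrix.mul_apply, Real.cos_add, Real.sin_add] <;> ring

lemma rot_zero : rot 0 = 1 := by
  ext i j
  fin_cases i <;> fin_cases j <;> simp [rot]

/-- The map `x ↦ ‖x‖ x` has the Lipschitz bound of a quadratic map. -/
lemma norm_norm_smul_sub_le {F : Type*} [NormedAddCommGroup F] [NormedSpace ℝ F] (x y : F) :
    ‖‖x‖ • x - ‖y‖ • y‖ ≤ (‖x‖ + ‖y‖) * ‖x - y‖ := by
  have h : ‖x‖ • x - ‖y‖ • y = ‖x‖ • (x - y) + (‖x‖ - ‖y‖) • y := by module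
  calc _ ≤ ‖‖x‖ • (x - y)‖ + ‖(‖x‖ - ‖y‖) • y‖ := h ▸ norm_add_le _ _
    _ = ‖x‖ * ‖x - y‖ + |‖x‖ - ‖y‖| * ‖y‖ := by simp [norm_smul]
    _ ≤ ‖x‖ * ‖x - y‖ + ‖x - y‖ * ‖y‖ := by gcongr; exact abs_norm_sub_norm_le x y
    _ = _ := by ring

namespace OscillatorNetwork

variable {N : ℕ} (net : OscillatorNetwork N)

lemma norm_sq_eq_sum_block (v : State N) : ‖v‖ ^ 2 = ∑ k, ‖block v k‖ ^ 2 := by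
  simp [EuclideanSpace.norm_sq_eq, block, Fintype.sum_prod_type]

lemma norm_block_le (v : State N) (k : Fin N) : ‖block v k‖ ≤ ‖v‖ := by
  refine le_of_sq_le_sq ?_ (norm_nonneg v)
  rw [norm_sq_eq_sum_block v]
  exact Finset.single_le_sum (f := fun k => ‖block v k‖ ^ 2) (fun _ _ => by positivity)
    (Finset.mem_univ k)

lemma block_sub (v w : State N) (k : Fin N) : block (v - w) k = block v k - block w k := rfl

lemma diagBlocks_mulVec (A : Fin N → Matrix (Fin 2) (Fin 2) ℝ) (v : Fin N × Fin 2 → ℝ)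
    (k : Fin N) (i : Fin 2) :
    (diagBlocks A).mulVec v (k, i) = (A k).mulVec (fun j => v (k, j)) i := by
  simp [Matrix.mulVec, dotProduct, diagBlocks, Fintype.sum_prod_type, ite_mul,
    Finset.sum_ite_irrel]

/-- The Jacobian of the rotating-frame field at the origin. -/
noncomputable def jacobian (η α : ℝ) : Matrix (Fin N × Fin 2) (Fin N × Fin 2) ℝ :=
  η • (net.gain - net.extLaplacian) + α • 1

lemma rotatingField_eq (η α : ℝ) (v : State N) (k : Fin N) :
    block (net.rotatingField η α v) k =
      block (Matrix.toEuclideanCLM (𝕜 := ℝ) (net.jacobian η α) v) k -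
        (α / net.vstar k) • (‖block v k‖ • block v k) := by
  have hk := (net.vstar_pos k).ne'
  ext i
  have h := diagBlocks_mulVec (fun k => net.magError k (block v k) • 1) v.ofLp k i
  simp [block, rotatingField, jacobian, magErrorMatrix, Matrix.smul_mulVec,
    Matrix.ofLp_toEuclideanCLM] at h ⊢
  rw [h, magError]
  field_simp
  ring

lemma isInwardPerturbation_rotatingField {η α : ℝ} (hα : 0 < α) :
    IsInwardPerturbation (net.rotatingField η α)
      (Matrix.toEuclideanCLM (𝕜 := ℝ) (net.jacobian η α)) (∑ k, α / net.vstar k) where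
  nonneg := Finset.sum_nonneg fun k _ => (div_pos hα (net.vstar_pos k)).le
  map_zero := by simp [rotatingField]
  norm_sub_le x y := by
    set C := ∑ k, α / net.vstar k
    have hpos (k) : 0 < α / net.vstar k := div_pos hα (net.vstar_pos k)
    have hC : 0 ≤ C := Finset.sum_nonneg fun k _ => (hpos k).le
    refine le_of_sq_le_sq ?_ (by positivity)
    rw [mul_pow, norm_sq_eq_sum_block, norm_sq_eq_sum_block (x - y), Finset.mul_sum]
    refine Finset.sum_le_sum fun k _ => ?_
    rw [← mul_pow]
    have hb : block (net.rotatingField η α x - net.rotatingField η α y -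
        Matrix.toEuclideanCLM (𝕜 := ℝ) (net.jacobian η α) (x - y)) k =
        -((α / net.vstar k) • (‖block x k‖ • block x k - ‖block y k‖ • block y k)) := by
      rw [block_sub, block_sub, rotatingField_eq, rotatingField_eq, map_sub, block_sub]
      module
    rw [hb, norm_neg, norm_smul, Real.norm_of_nonneg (hpos k).le, block_sub]
    have h1 := norm_norm_smul_sub_le (block x k) (block y k)
    have h2 : α / net.vstar k ≤ C :=
      Finset.single_le_sum (fun j _ => (hpos j).le) (Finset.mem_univ k)
    refine pow_le_pow_left₀ (by have := (hpos k).le; positivity) ?_ 2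
    calc _ ≤ C * ((‖block x k‖ + ‖block y k‖) * ‖block x k - block y k‖) := by gcongr
      _ ≤ C * ((‖x‖ + ‖y‖) * ‖block x k - block y k‖) := by
        gcongr <;> exact norm_block_le _ k
      _ = _ := by ring
  inner_le x := by
    have hsum (v : State N) : ⟪x, v⟫ = ∑ k, ⟪block x k, block v k⟫ := by
      simp [PiLp.inner_apply, block, Fintype.sum_prod_type]
    rw [hsum, hsum]
    refine Finset.sum_le_sum fun k _ => ?_
    rw [rotatingField_eq, inner_sub_right, real_inner_smul_right, real_inner_smul_right,
      real_inner_self_eq_norm_sq]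
    have := (div_pos hα (net.vstar_pos k)).le
    have : 0 ≤ α / net.vstar k * (‖block x k‖ * ‖block x k‖ ^ 2) := by positivity
    linarith

/-- The two-dimensional space of states in which every oscillator is at its set-point, up to a
common planar vector `w`: oscillator `k` has the state `v⋆_k R(θ⋆_k) w`. -/
noncomputable def synchronized : (Fin 2 → ℝ) →ₗ[ℝ] (Fin N × Fin 2 → ℝ) where
  toFun w p := net.vstar p.1 * (rot (net.theta p.1)).mulVec w p.2
  map_add' w w' := by ext p; simp [Matrix.mulVec_add, mul_add]
  map_smul' c w := by ext p; simp [Matrix.mulVec_smul]; ring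

lemma synchronized_injective : Function.Injective net.synchronized := by
  obtain ⟨k⟩ := net.connected.nonempty
  rw [← LinearMap.ker_eq_bot, LinearMap.ker_eq_bot']
  intro w hw
  have h0 : (rot (net.theta k)).mulVec w = 0 := by
    ext i
    have h : net.vstar k * (rot (net.theta k)).mulVec w i = 0 := congrFun hw (k, i)
    exact (mul_eq_zero.1 h).resolve_left (net.vstar_pos k).ne'
  have h1 : (rot (-net.theta k)).mulVec ((rot (net.theta k)).mulVec w) = w := by
    rw [Matrix.mulVec_mulVec, rot_mul_rot, neg_add_cancel, rot_zero, Matrix.one_mulVec]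
  rw [← h1, h0, Matrix.mulVec_zero]

open Classical in
lemma incidence_mul_sum (x : Fin N → ℝ) {j k : Fin N} (h : net.graph.Adj j k) :
    net.incidence k ⟨s(j, k), h⟩ * ∑ i, net.incidence i ⟨s(j, k), h⟩ * x i = x k - x j := by
  have hne : j ≠ k := h.ne
  have hs := net.sink_mem ⟨s(j, k), h⟩
  rw [Finset.sum_eq_add j k hne (fun i _ hi => ?_) (by simp) (by simp)]
  · rcases Sym2.mem_iff.1 hs with hs | hs <;> simp [incidence, hs, hne, hne.symm] <;> ring
  · rcases Sym2.mem_iff.1 hs with hs | hs <;> simp [incidence, hs, hi]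

open Classical in
lemma laplacian_mulVec (x : Fin N → ℝ) (k : Fin N) :
    net.laplacian.mulVec x k =
      ∑ j with net.graph.Adj j k, net.weight s(j, k) * (x k - x j) := by
  have h1 : net.laplacian.mulVec x k =
      ∑ e : net.graph.edgeSet, net.weight e * (net.incidence k e * ∑ i, net.incidence i e * x i) := by
    simp only [laplacian, ← Matrix.mulVec_mulVec]
    simp only [Matrix.mulVec, dotProduct, Matrix.diagonal_apply, ite_mul, zero_mul,
      Finset.sum_ite_eq, Finset.mem_univ, if_true, Matrix.transpose_apply]
    exact Finset.sum_congr (by congr) fun e _ => by ring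
  rw [h1]
  -- only the edges at `k` contribute, and these correspond to the neighbours of `k`
  rw [← Finset.sum_filter_of_ne (p := fun e : net.graph.edgeSet => k ∈ (e : Sym2 (Fin N)))]
  · symm
    refine Finset.sum_bij (fun j hj => ⟨s(j, k), (Finset.mem_filter.1 hj).2⟩) ?_ ?_ ?_ ?_
    · intro j hj
      simp
    · intro i hi j hj hij
      have hij : s(i, k) = s(j, k) := congrArg Subtype.val hij
      exact Sym2.congr_left.1 hij
    · rintro ⟨e, he⟩ hk
      obtain ⟨j, rfl⟩ := Sym2.mem_iff_exists.1 (Finset.mem_filter.1 hk).2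
      exact ⟨j, Finset.mem_filter.2 ⟨Finset.mem_univ _, (show net.graph.Adj k j from he).symm⟩,
        Subtype.ext Sym2.eq_swap⟩
    · intro j hj
      rw [net.incidence_mul_sum]
  · intro e _ he
    by_contra hk
    have hsink : k ≠ net.sink e := fun h => hk (h ▸ net.sink_mem e)
    exact he (by simp [incidence, hk, hsink])

lemma extLaplacian_mulVec (v : Fin N × Fin 2 → ℝ) (k : Fin N) (i : Fin 2) :
    net.extLaplacian.mulVec v (k, i) = net.laplacian.mulVec (fun j => v (j, i)) k := by
  simp [Matrix.mulVec, dotProduct, extLaplacian, Fintype.sum_prod_type, Matrix.one_apply]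

/-- Synchronized states are in the kernel of `𝓚 - 𝓛`: the gains `K_k` are chosen to cancel the
coupling at the set-points. -/
lemma gain_sub_extLaplacian_mulVec_synchronized (w : Fin 2 → ℝ) :
    (net.gain - net.extLaplacian).mulVec (net.synchronized w) = 0 := by
  classical
  ext ⟨k, i⟩
  rw [Matrix.sub_mulVec, Pi.sub_apply, Pi.zero_apply, sub_eq_zero, gain, diagBlocks_mulVec,
    extLaplacian_mulVec, laplacian_mulVec, gainBlock, Matrix.sum_mulVec, Finset.sum_apply]
  refine Finset.sum_congr (by congr) fun j _ => ?_
  have hk := (net.vstar_pos k).ne'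
  have hw : (fun b => net.synchronized w (k, b)) =
      net.vstar k • (rot (net.theta k)).mulVec w := rfl
  have hrot : (rot (net.theta j - net.theta k)).mulVec ((rot (net.theta k)).mulVec w) =
      (rot (net.theta j)).mulVec w := by
    rw [Matrix.mulVec_mulVec, rot_mul_rot, sub_add_cancel]
  rw [hw, Matrix.smul_mulVec, Matrix.sub_mulVec, Matrix.one_mulVec, Matrix.smul_mulVec,
    Matrix.mulVec_smul, hrot]
  simp only [synchronized, LinearMap.coe_mk, AddHom.coe_mk, Pi.smul_apply, Pi.sub_apply,
    smul_eq_mul]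
  field_simp

lemma jacobian_mulVec_synchronized (η α : ℝ) (w : Fin 2 → ℝ) :
    (net.jacobian η α).mulVec (net.synchronized w) = α • net.synchronized w := by
  rw [jacobian, Matrix.add_mulVec, Matrix.smul_mulVec, gain_sub_extLaplacian_mulVec_synchronized,
    Matrix.smul_mulVec, Matrix.one_mulVec, smul_zero, zero_add]

/-- The algebraic multiplicity of `α` is at least its geometric multiplicity, and the synchronized
states are a plane of eigenvectors. -/
lemma two_le_rootMultiplicity_charpoly_jacobian (η α : ℝ) :
    2 ≤ (net.jacobian η α).charpoly.rootMultiplicity α := by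
  have hle : LinearMap.range net.synchronized ≤
      Module.End.eigenspace (Matrix.toLin' (net.jacobian η α)) α := by
    rintro _ ⟨w, rfl⟩
    rw [Module.End.mem_eigenspace_iff, Matrix.toLin'_apply, jacobian_mulVec_synchronized]
  have h := Submodule.finrank_mono hle
  rw [LinearMap.finrank_range_of_inj net.synchronized_injective, Module.finrank_fin_fun] at h
  refine h.trans ?_
  rw [← Matrix.charpoly_toLin']
  exact LinearMap.finrank_eigenspace_le _ _

end OscillatorNetwork

/-- A positive real root of multiplicity at least `m` gives at least `m` complex roots with positive
real part. -/
lemma le_card_filter_roots_of_le_rootMultiplicity {p : Polynomial ℝ} {α : ℝ}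
    (hα : 0 < α) {m : ℕ} (h : m ≤ p.rootMultiplicity α) :
    m ≤ Multiset.card ((p.map (algebraMap ℝ ℂ)).roots.filter fun μ : ℂ => 0 < μ.re) := by
  classical
  -- all `m` roots are copies of `α` itself
  calc m ≤ p.rootMultiplicity α := h
    _ = (p.map (algebraMap ℝ ℂ)).rootMultiplicity (algebraMap ℝ ℂ α) :=
      Polynomial.eq_rootMultiplicity_map (algebraMap ℝ ℂ).injective α
    _ = ((p.map (algebraMap ℝ ℂ)).roots.filter fun μ : ℂ => 0 < μ.re).count (algebraMap ℝ ℂ α) := by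
      rw [Multiset.count_filter_of_pos (by simpa using hα), Polynomial.count_roots]
    _ ≤ _ := Multiset.count_le_card _ _

theorem mainTheorem4 {N : ℕ} (net : OscillatorNetwork N) (η α : ℝ) (hη : 0 < η) (hα : 0 < α) :
    -- every initial value problem has exactly one solution on `[0, ∞)`, namely `solutionMap`
    (∀ v₀ : OscillatorNetwork.State N,
      IsForwardSolution (net.rotatingField η α) v₀
        (fun t => solutionMap (net.rotatingField η α) t v₀) ∧
      ∀ x : ℝ → OscillatorNetwork.State N, IsForwardSolution (net.rotatingField η α) v₀ x →
        ∀ t : ℝ, 0 ≤ t → x t = solutionMap (net.rotatingField η α) t v₀) ∧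
    -- the origin is an equilibrium, and it is unstable
    net.rotatingField η α 0 = 0 ∧
    ¬ IsStableWrt (net.rotatingField η α) {0} ∧
    -- the Jacobian at the origin
    HasFDerivAt (net.rotatingField η α)
      (Matrix.toEuclideanCLM (𝕜 := ℝ) (η • (net.gain - net.extLaplacian) + α • 1)) 0 ∧
    -- it has at least two complex eigenvalues (with multiplicity) with positive real part
    2 ≤ Multiset.card
      ((((η • (net.gain - net.extLaplacian) + α • 1).map (algebraMap ℝ ℂ)).charpoly.roots).filter
        (fun μ : ℂ => 0 < μ.re)) ∧
    -- the set of initial conditions attracted by the origin is Lebesgue-null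
    volume (originBasin (net.rotatingField η α)) = 0 := by
  have hf := net.isInwardPerturbation_rotatingField (η := η) hα
  have hrad := hf.isRadiallyBounded
  -- any nonzero planar vector gives an eigenvector of the Jacobian with eigenvalue `α`
  set u : OscillatorNetwork.State N := WithLp.toLp 2 (net.synchronized ![1, 0]) with hu
  have hu0 : u ≠ 0 := by
    intro h
    have h0 : net.synchronized ![1, 0] = 0 := congrArg WithLp.ofLp h
    simpa using congrFun (net.synchronized_injective (h0.trans (map_zero _).symm)) 0
  have hAu : Matrix.toEuclideanCLM (𝕜 := ℝ) (net.jacobian η α) u = α • u := by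
    rw [hu, Matrix.toEuclideanCLM_toLp, net.jacobian_mulVec_synchronized, WithLp.toLp_smul]
  refine ⟨fun v₀ => ⟨hrad.isForwardSolution_solutionMap v₀, fun x hx t ht =>
    hrad.eq_of_isForwardSolution hx (hrad.isForwardSolution_solutionMap v₀) ht⟩, hf.map_zero,
    hf.not_isStableWrt hα hu0 hAu, hf.hasFDerivAt, ?_, hf.measure_originBasin volume hα hu0 hAu⟩
  rw [Matrix.charpoly_map]
  exact le_card_filter_roots_of_le_rootMultiplicity hα
    (net.two_le_rootMultiplicity_charpoly_jacobian η α)
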